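/- Let $M$ be a compact connected Riemannian manifold without boundary of dimension $N\ge 1$, with geodesic distance $s_{xy}$. Fix a point $O\in M$ and suppose that for every $x\in M$ there is an isometry $\tau_x:M\to M$ with $\tau_x(x)=O$. Let $\mu$ be a Borel measure on $M$ that is invariant under all $\tau_x$, and let $J:\mathbb R_{\ge0}\to\mathbb R_{\ge0}$ satisfy $\int_M J(s_{xO})\,d\mu_x=1$. Suppose that $J(s)>0$ for $0\le s<s_0$, for some $s_0>0$, and that $J$ is Lipschitz in $M$, i.e. the functions $y\mapsto J(s_{xy})$, $x\in M$, are Lipschitz on $M$ with a common constant. Put $$Lu(x)=\int_M J(s_{xy})\,u(y)\,d\mu_y-u(x).$$ A real number $\lambda$ is an eigenvalue of $-L$ if $-L\varphi=\lambda\varphi$ for some nonzero $\varphi\in L^2(M)=L^2(M,\mu)$. Let $\lambda_1$ be the first nonzero eigenvalue of $-L$, or, precisely, the infimum of the nonzero eigenvalues of $-L$. Then there are nonzero eigenvalues, $\lambda_1>0$, and $\lambda_1$ is itself an eigenvalue (hence the smallest nonzero one) except possibly if $\lambda_1=1$. Moreover, let $u_0\in L^2(M)$ and let $u\in C([0,\infty);L^1(M))$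 be a solution of $u_t=Lu$ for $t>0$ (with $u_t$ taken in $L^1(M)$) with $u(\cdot,0)=u_0$. Then for all $t\ge0$ $$\|u(\cdot,t)-\langle u_0\rangle\|_{L^2(M)}\le e^{-\lambda_1 t}\,\|u_0\|_{L^2(M)},\qquad \langle u_0\rangle=\frac1{\mu(M)}\int_M u_0\,d\mu .$$ In particular, $u(\cdot,t)\to\langle u_0\rangle$ in $L^2(M)$ as $t\to\infty$. -/

import Mathlib

open MeasureTheory Filter Topology Bundle
open scoped Manifold NNReal ENNReal

noncomputable section

/-- The nonlocal diffusion operator `L f (x) = ∫ J(s_{xy}) f(y) dμ_y - f(x)`, where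
`s_{xy}` is the distance of `x` and `y`. -/
def nonlocalOp {M : Type*} [MetricSpace M] [MeasurableSpace M] (J : ℝ≥0 → ℝ≥0) (μ : Measure M)
    (f : M → ℝ) (x : M) : ℝ :=
  (∫ y, (J (nndist x y) : ℝ) * f y ∂μ) - f x

/-- `u ∈ C([0,∞); L¹(M))` solves `u_t = L u` for `t > 0` (the time derivative being taken
in `L¹(M)`), with `u(·,0) = u₀`. The values of `u` at negative times are irrelevant. -/
structure IsNonlocalSolution {M : Type*} [MetricSpace M] [MeasurableSpace M] (J : ℝ≥0 → ℝ≥0)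
    (μ : Measure M) (u₀ : M → ℝ) (u : ℝ → Lp ℝ 1 μ) : Prop where
  continuousOn : ContinuousOn u (Set.Ici 0)
  initial : ⇑(u 0) =ᵐ[μ] u₀
  equation : ∀ t : ℝ, 0 < t →
    ∃ v : Lp ℝ 1 μ, ⇑v =ᵐ[μ] nonlocalOp J μ (u t) ∧ HasDerivAt u v t

/-- The nonzero eigenvalues of `-L`, as an operator in `L²(M)`. -/
def nonzeroEigenvalues {M : Type*} [MetricSpace M] [MeasurableSpace M] (J : ℝ≥0 → ℝ≥0)
    (μ : Measure M) : Set ℝ :=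
  {l | l ≠ 0 ∧ ∃ φ : Lp ℝ 2 μ, φ ≠ 0 ∧ ∀ᵐ x ∂μ, -nonlocalOp J μ φ x = l * φ x}

end

/-! Write L = T - 1, where T integrates against the continuous symmetric kernel J(s_{xy}).
Homogeneity carries the normalisation at O to every point, so T fixes constants and, being
symmetric, preserves the functions of mean zero; let S be T restricted to these. Continuity of the
kernel makes T compact (Arzelà–Ascoli, `isCompactOperator_kernelToBCF`).

Let c be the supremum of the eigenvalues of S. By the maximum principle on the connected space M,
every eigenvalue of S is below 1 (`eigenvalue_lt_one`). If c is nonzero, compactness makes it an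
eigenvalue; hence c < 1 in all cases. The nonzero eigenvalues of -L are exactly the numbers 1 - κ
with κ an eigenvalue of S (`mem_nonzeroEigenvalues_iff`), so λ₁ = 1 - c, and the exception λ₁ = 1 is
the case c = 0, where eigenvalues of a compact operator may accumulate.

Eigenvectors of S span a dense subspace, so ⟨Sf, f⟩ ≤ c‖f‖², and an energy estimate gives the rate
e^{-λ₁t} for the mean-zero flow in L². Uniqueness in L¹ identifies the given solution with this flow
plus its mean (`solution_eq_meanZero_add_const`). -/

/-! ### Compact symmetric operators and linear evolution equations -/

section Hilbert

variable {V : Type*} [NormedAddCommGroup V] [InnerProductSpace ℝ V] [CompleteSpace V]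

/-- The quadratic form of a compact symmetric operator is bounded by any upper bound of its
eigenvalues. -/
theorem inner_apply_le_of_hasEigenvalue_le {T : V →L[ℝ] V} (hT : IsCompactOperator T)
    (hs : T.IsSymmetric) {c : ℝ}
    (hc : ∀ κ, Module.End.HasEigenvalue (T : Module.End ℝ V) κ → κ ≤ c) (v : V) :
    inner ℝ (T v) v ≤ c * ‖v‖ ^ 2 := by
  classical
  have hdense : Dense ((⨆ κ, Module.End.eigenspace (T : Module.End ℝ V) κ : Submodule ℝ V) :
      Set V) := by
    rw [Submodule.dense_iff_topologicalClosure_eq_top, Submodule.topologicalClosure_eq_top_iff]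
    exact ContinuousLinearMap.orthogonalComplement_iSup_eigenspaces_eq_bot hT hs
  -- Both sides are continuous in v, so finite sums of eigenvectors suffice; orthogonality of the
  -- eigenspaces diagonalises the form on them.
  refine hdense.induction (P := fun v => inner ℝ (T v) v ≤ c * ‖v‖ ^ 2) ?_
    (isClosed_le (by fun_prop) (by fun_prop)) v
  intro w hw
  obtain ⟨f, rfl⟩ := (Submodule.mem_iSup_iff_exists_dfinsupp' _ w).1 hw
  have horth := hs.orthogonalFamily_eigenspaces
  have hTf : T (f.sum fun _ xi => (xi : V)) =
      ∑ i ∈ f.support, (Module.End.eigenspace (T : Module.End ℝ V) i).subtypeₗᵢ (i • f i) := by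
    rw [DFinsupp.sum, map_sum]
    refine Finset.sum_congr rfl fun i _ => ?_
    have := Module.End.mem_eigenspace_iff.1 (f i).2
    simpa using this
  have hf : (f.sum fun _ xi => (xi : V)) =
      ∑ i ∈ f.support, (Module.End.eigenspace (T : Module.End ℝ V) i).subtypeₗᵢ (f i) := rfl
  rw [hTf, hf, horth.inner_sum, horth.norm_sum, Finset.mul_sum]
  refine Finset.sum_le_sum fun i hi => ?_
  rw [real_inner_smul_left, real_inner_self_eq_norm_sq]
  refine mul_le_mul_of_nonneg_right (hc i ?_) (by positivity)
  refine Module.End.hasEigenvalue_of_hasEigenvector (x := (f i : V)) ⟨(f i).2, ?_⟩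
  simpa using hi

/-- A compact symmetric operator on a nontrivial space has an eigenvalue. -/
theorem exists_hasEigenvalue_of_isCompactOperator [Nontrivial V] {T : V →L[ℝ] V}
    (hT : IsCompactOperator T) (hs : T.IsSymmetric) :
    ∃ κ, Module.End.HasEigenvalue (T : Module.End ℝ V) κ := by
  by_contra! h
  have h1 := ContinuousLinearMap.orthogonalComplement_iSup_eigenspaces_eq_bot hT hs
  have h2 : (⨆ κ, Module.End.eigenspace (T : Module.End ℝ V) κ) = ⊥ := by
    rw [iSup_eq_bot]
    intro κ
    by_contra hne
    exact h κ (Module.End.hasEigenvalue_iff.2 hne)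
  rw [h2, Submodule.bot_orthogonal_eq_top] at h1
  exact top_ne_bot h1

omit [CompleteSpace V] in
/-- The eigenvalues of a bounded operator are bounded by its norm. -/
theorem le_opNorm_of_hasEigenvalue {T : V →L[ℝ] V} {κ : ℝ}
    (h : Module.End.HasEigenvalue (T : Module.End ℝ V) κ) : κ ≤ ‖T‖ := by
  obtain ⟨x, hx⟩ := h.exists_hasEigenvector
  have h1 : T x = κ • x := hx.apply_eq_smul
  have h2 : ‖κ‖ * ‖x‖ ≤ ‖T‖ * ‖x‖ := by
    rw [← norm_smul, ← h1]
    exact T.le_opNorm x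
  exact (le_abs_self κ).trans (le_of_mul_le_mul_right h2 (norm_pos_iff.2 hx.2))

/-- A nonzero least upper bound of the eigenvalues of a compact operator is an eigenvalue. -/
theorem hasEigenvalue_of_isLUB [Nontrivial V] {T : V →L[ℝ] V} (hT : IsCompactOperator T)
    {c : ℝ} (hne : {κ | Module.End.HasEigenvalue (T : Module.End ℝ V) κ}.Nonempty)
    (hc : IsLUB {κ | Module.End.HasEigenvalue (T : Module.End ℝ V) κ} c) (hc0 : c ≠ 0) :
    Module.End.HasEigenvalue (T : Module.End ℝ V) c := by
  have h1 : c ∈ closure {κ | Module.End.HasEigenvalue (T : Module.End ℝ V) κ} :=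
    hc.mem_closure hne
  have h2 : {κ | Module.End.HasEigenvalue (T : Module.End ℝ V) κ} ⊆ spectrum ℝ T := by
    intro κ hκ
    rw [ContinuousLinearMap.spectrum_eq]
    exact hκ.mem_spectrum
  -- The spectrum is closed, and nonzero spectral values of a compact operator are eigenvalues.
  exact (hT.hasEigenvalue_iff_mem_spectrum hc0).2
    (closure_minimal h2 (spectrum.isClosed T) h1)

/-- The linear initial value problem `y' = A y`, `y 0 = v` with a bounded operator `A` is
solvable. -/
theorem exists_hasDerivAt_clm (A : V →L[ℝ] V) (v : V) :
    ∃ y : ℝ → V, y 0 = v ∧ ∀ t, HasDerivAt y (A (y t)) t :=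
  ⟨fun t => NormedSpace.exp (t • A) v, by simp, fun t => by
    simpa using (hasDerivAt_exp_smul_const' (𝕂 := ℝ) A t).clm_apply (hasDerivAt_const t v)⟩

omit [CompleteSpace V] in
/-- Exponential decay of the solutions of `y' = A y` under a dissipativity bound on `A`. -/
theorem norm_le_exp_mul_of_hasDerivAt_clm {A : V →L[ℝ] V} {l : ℝ}
    (hA : ∀ v, inner ℝ (A v) v ≤ -l * ‖v‖ ^ 2) {y : ℝ → V}
    (hd : ∀ t, HasDerivAt y (A (y t)) t) {t : ℝ} (ht : 0 ≤ t) :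
    ‖y t‖ ≤ Real.exp (-l * t) * ‖y 0‖ := by
  -- With this integrating factor, dissipativity says precisely that g is nonincreasing.
  set g : ℝ → ℝ := fun t => Real.exp (2 * l * t) * ‖y t‖ ^ 2 with hg
  have hgd : ∀ t, HasDerivAt g (Real.exp (2 * l * t) * (2 * l) * ‖y t‖ ^ 2 +
      Real.exp (2 * l * t) * (2 * inner ℝ (y t) (A (y t)))) t := fun t => by
    have h1 : HasDerivAt (fun t : ℝ => Real.exp (2 * l * t)) (Real.exp (2 * l * t) * (2 * l)) t :=
      by simpa using ((hasDerivAt_id t).const_mul (2 * l)).exp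
    exact h1.mul (hd t).norm_sq
  have hanti : Antitone g := antitone_of_hasDerivAt_nonpos hgd fun t => by
    have := hA (y t)
    rw [real_inner_comm] at this
    have he := Real.exp_pos (2 * l * t)
    have h2 := mul_le_mul_of_nonneg_left this he.le
    show _ ≤ (0 : ℝ)
    linarith
  have h0 : g t ≤ g 0 := hanti ht
  have hg0 : g 0 = ‖y 0‖ ^ 2 := by simp [hg]
  rw [hg0] at h0
  have h3 : ‖y t‖ ^ 2 ≤ (Real.exp (-l * t) * ‖y 0‖) ^ 2 := by
    have he : Real.exp (2 * l * t) * Real.exp (-l * t) ^ 2 = 1 := by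
      rw [sq, ← Real.exp_add, ← Real.exp_add]
      ring_nf
      simp
    have hpos := Real.exp_pos (2 * l * t)
    refine le_of_mul_le_mul_left ?_ hpos
    calc Real.exp (2 * l * t) * ‖y t‖ ^ 2 ≤ ‖y 0‖ ^ 2 := h0
      _ = (Real.exp (2 * l * t) * Real.exp (-l * t) ^ 2) * ‖y 0‖ ^ 2 := by rw [he, one_mul]
      _ = _ := by ring
  exact le_of_sq_le_sq h3 (by positivity)

end Hilbert

/-- Uniqueness for `d' = A d` with a bounded operator `A` and a solution that is differentiable
for positive times and continuous at time zero. -/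
theorem eqOn_zero_of_hasDerivAt_clm {E : Type*} [NormedAddCommGroup E] [NormedSpace ℝ E]
    (A : E →L[ℝ] E) {d : ℝ → E} (hd : ContinuousOn d (Set.Ici 0)) (h0 : d 0 = 0)
    (hd' : ∀ t, 0 < t → HasDerivAt d (A (d t)) t) {t : ℝ} (ht : 0 ≤ t) : d t = 0 := by
  have hderiv : ∀ s ∈ Set.Ico (0 : ℝ) t, HasDerivWithinAt d (A (d s)) (Set.Ici s) s := by
    intro s hs
    rcases hs.1.eq_or_lt with rfl | hpos
    -- No derivative is assumed at time 0; continuity there and the limit of A (d r) as r ↓ 0 supply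
    -- the right derivative.
    · refine hasDerivWithinAt_Ici_of_tendsto_deriv (s := Set.Ioi 0)
        (fun r hr => (hd' r hr).differentiableAt.differentiableWithinAt)
        ((hd 0 Set.self_mem_Ici).mono Set.Ioi_subset_Ici_self) self_mem_nhdsWithin ?_
      have h1 : Tendsto (fun r => A (d r)) (𝓝[>] 0) (𝓝 (A (d 0))) :=
        (A.continuous.tendsto _).comp
          ((hd 0 Set.self_mem_Ici).mono Set.Ioi_subset_Ici_self)
      exact h1.congr' (eventually_nhdsWithin_of_forall fun r hr => (hd' r hr).deriv.symm)
    · exact (hd' s hpos).hasDerivWithinAt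
  have := ODE_solution_unique (v := fun _ => A) (K := ‖A‖₊) (f := d) (g := fun _ => (0 : E))
    (a := 0) (b := t) (fun _ => A.lipschitz) (hd.mono Set.Icc_subset_Ici_self) hderiv
    continuousOn_const (fun s _ => by simpa using hasDerivWithinAt_const s (Set.Ici s) (0 : E)) h0
  exact this (Set.right_mem_Icc.2 ht)

/-! ### L² inside L¹ -/

section Inclusion

variable {M : Type*} [MeasurableSpace M] {μ : Measure M} [IsFiniteMeasure μ]

variable (μ) in
/-- The inclusion of `L²` into `L¹` over a finite measure space. -/
noncomputable def lpTwoToOne : Lp ℝ 2 μ →L[ℝ] Lp ℝ 1 μ :=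
  LinearMap.mkContinuous
    { toFun := fun f => ⟨f.1, Lp.antitone (by norm_num) f.2⟩
      map_add' := fun _ _ => rfl
      map_smul' := fun _ _ => rfl }
    (μ Set.univ ^ (1 / 2 : ℝ)).toReal fun f => by
      have h := eLpNorm_le_eLpNorm_mul_rpow_measure_univ (p := 1) (q := 2) (by norm_num)
        (Lp.aestronglyMeasurable f)
      rw [Lp.norm_def, Lp.norm_def, mul_comm, ← ENNReal.toReal_mul]
      refine ENNReal.toReal_mono (ENNReal.mul_ne_top (Lp.eLpNorm_ne_top f) ?_) ?_
      · exact ENNReal.rpow_ne_top_of_nonneg (by norm_num) (measure_ne_top _ _)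
      · rwa [show 1 / ENNReal.toReal 1 - 1 / ENNReal.toReal 2 = (1 / 2 : ℝ) by
          rw [ENNReal.toReal_one, ENNReal.toReal_ofNat]; norm_num] at h

theorem coe_lpTwoToOne (f : Lp ℝ 2 μ) : (lpTwoToOne μ f : M → ℝ) = f := rfl

theorem integrable_coe_lpTwo (f : Lp ℝ 2 μ) : Integrable f μ :=
  (Lp.memLp f).integrable (by norm_num)

end Inclusion

/-! ### Integral operators with continuous kernel -/

section Kernel

variable {M : Type*} [MetricSpace M] [CompactSpace M] [MeasurableSpace M] [BorelSpace M]
  {μ : Measure M}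

theorem integrable_continuousMap_mul (g : C(M, ℝ)) {f : M → ℝ} (hf : Integrable f μ) :
    Integrable (fun y => g y * f y) μ :=
  hf.bdd_mul (c := ‖g‖) g.continuous.aestronglyMeasurable (ae_of_all _ g.norm_coe_le_norm)

theorem abs_integral_continuousMap_mul_le (g : C(M, ℝ)) (f : Lp ℝ 1 μ) :
    |∫ y, g y * f y ∂μ| ≤ ‖g‖ * ‖f‖ := by
  rw [L1.norm_eq_integral_norm, ← integral_const_mul, ← Real.norm_eq_abs]
  refine (norm_integral_le_integral_norm _).trans ?_
  refine integral_mono (integrable_continuousMap_mul g (L1.integrable_coeFn f)).norm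
    ((L1.integrable_coeFn f).norm.const_mul _) fun y => ?_
  simp only [norm_mul]
  exact mul_le_mul_of_nonneg_right (g.norm_coe_le_norm y) (norm_nonneg _)

theorem abs_integral_kernel_sub_le (k : C(M, C(M, ℝ))) (f : Lp ℝ 1 μ) (x x' : M) :
    |(∫ y, k x y * f y ∂μ) - ∫ y, k x' y * f y ∂μ| ≤ ‖k x - k x'‖ * ‖f‖ := by
  rw [← integral_sub (integrable_continuousMap_mul _ (L1.integrable_coeFn f))
    (integrable_continuousMap_mul _ (L1.integrable_coeFn f))]
  simpa [sub_mul] using abs_integral_continuousMap_mul_le (k x - k x') f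

theorem continuous_integral_kernel (k : C(M, C(M, ℝ))) (f : Lp ℝ 1 μ) :
    Continuous fun x => ∫ y, k x y * f y ∂μ := by
  refine continuous_iff_continuousAt.2 fun x₀ => ?_
  refine tendsto_iff_dist_tendsto_zero.2 ?_
  refine squeeze_zero (fun _ => dist_nonneg) (fun x => ?_)
    (g := fun x => ‖k x - k x₀‖ * ‖f‖) ?_
  · exact abs_integral_kernel_sub_le k f x x₀
  · have : Continuous fun x => ‖k x - k x₀‖ * ‖f‖ := by fun_prop
    simpa using this.tendsto x₀

variable (μ) in
/-- The integral operator with a continuous kernel, from `L¹` to bounded continuous functions. -/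
noncomputable def kernelToBCF (k : C(M, C(M, ℝ))) : Lp ℝ 1 μ →L[ℝ] BoundedContinuousFunction M ℝ :=
  LinearMap.mkContinuous
    { toFun := fun f => BoundedContinuousFunction.mkOfCompact
        ⟨fun x => ∫ y, k x y * f y ∂μ, continuous_integral_kernel k f⟩
      map_add' := fun f g => by
        ext x
        simp only [BoundedContinuousFunction.mkOfCompact_apply, ContinuousMap.coe_mk,
          BoundedContinuousFunction.coe_add, Pi.add_apply]
        rw [← integral_add (integrable_continuousMap_mul _ (L1.integrable_coeFn f))
          (integrable_continuousMap_mul _ (L1.integrable_coeFn g))]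
        refine integral_congr_ae ?_
        filter_upwards [Lp.coeFn_add f g] with y hy
        rw [hy, Pi.add_apply, mul_add]
      map_smul' := fun c f => by
        ext x
        simp only [BoundedContinuousFunction.mkOfCompact_apply, ContinuousMap.coe_mk,
          BoundedContinuousFunction.coe_smul, RingHom.id_apply, smul_eq_mul]
        rw [← integral_const_mul]
        refine integral_congr_ae ?_
        filter_upwards [Lp.coeFn_smul c f] with y hy
        rw [hy, Pi.smul_apply, smul_eq_mul]
        ring }
    ‖k‖ fun f => by
      rw [BoundedContinuousFunction.norm_le (by positivity)]
      intro x
      exact (abs_integral_continuousMap_mul_le (k x) f).trans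
        (mul_le_mul_of_nonneg_right (k.norm_coe_le_norm x) (norm_nonneg _))

/-- On the unit ball of L¹ the images are bounded by ‖k‖ and share the modulus of continuity of x ↦
k x, so Arzelà–Ascoli applies. -/
theorem isCompactOperator_kernelToBCF (k : C(M, C(M, ℝ))) :
    IsCompactOperator (kernelToBCF μ k) := by
  refine (isCompactOperator_iff_isCompact_closure_image_closedBall
    (kernelToBCF μ k : Lp ℝ 1 μ →ₗ[ℝ] BoundedContinuousFunction M ℝ) one_pos).2 ?_
  refine BoundedContinuousFunction.arzela_ascoli (Metric.closedBall 0 ‖k‖)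
    (isCompact_closedBall _ _) _ ?_ ?_
  · rintro _ x ⟨f, hf, rfl⟩
    rw [mem_closedBall_zero_iff] at hf ⊢
    refine (abs_integral_continuousMap_mul_le (k x) f).trans ?_
    exact (mul_le_mul (k.norm_coe_le_norm x) hf (norm_nonneg _) (norm_nonneg _)).trans
      (mul_one _).le
  · intro x₀
    rw [Metric.equicontinuousAt_iff_right]
    intro ε hε
    have hcont : Continuous fun x => ‖k x₀ - k x‖ := by fun_prop
    have hlt : ∀ᶠ x in 𝓝 x₀, ‖k x₀ - k x‖ < ε :=
      (hcont.tendsto x₀).eventually_lt_const (by simpa using hε)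
    filter_upwards [hlt] with x hx
    rintro ⟨_, f, hf, rfl⟩
    rw [mem_closedBall_zero_iff] at hf
    refine lt_of_le_of_lt (abs_integral_kernel_sub_le k f x₀ x) (lt_of_le_of_lt ?_ hx)
    exact mul_le_of_le_one_right (norm_nonneg _) hf

variable [IsFiniteMeasure μ]

variable (μ) in
/-- The integral operator with a continuous kernel on `L¹`. -/
noncomputable def kernelLpOne (k : C(M, C(M, ℝ))) : Lp ℝ 1 μ →L[ℝ] Lp ℝ 1 μ :=
  (BoundedContinuousFunction.toLp 1 μ ℝ).comp (kernelToBCF μ k)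

variable (μ) in
/-- The integral operator with a continuous kernel on `L²`. -/
noncomputable def kernelLpTwo (k : C(M, C(M, ℝ))) : Lp ℝ 2 μ →L[ℝ] Lp ℝ 2 μ :=
  (BoundedContinuousFunction.toLp 2 μ ℝ).comp ((kernelToBCF μ k).comp (lpTwoToOne μ))

theorem coeFn_kernelLpOne (k : C(M, C(M, ℝ))) (f : Lp ℝ 1 μ) :
    kernelLpOne μ k f =ᵐ[μ] fun x => ∫ y, k x y * f y ∂μ :=
  BoundedContinuousFunction.coeFn_toLp 1 μ ℝ _

theorem coeFn_kernelLpTwo (k : C(M, C(M, ℝ))) (f : Lp ℝ 2 μ) :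
    kernelLpTwo μ k f =ᵐ[μ] fun x => ∫ y, k x y * f y ∂μ :=
  BoundedContinuousFunction.coeFn_toLp 2 μ ℝ _

theorem lpTwoToOne_kernelLpTwo (k : C(M, C(M, ℝ))) (f : Lp ℝ 2 μ) :
    lpTwoToOne μ (kernelLpTwo μ k f) = kernelLpOne μ k (lpTwoToOne μ f) := by
  refine Lp.ext ?_
  exact (coeFn_kernelLpTwo k f).trans (coeFn_kernelLpOne k (lpTwoToOne μ f)).symm

theorem isCompactOperator_kernelLpTwo (k : C(M, C(M, ℝ))) :
    IsCompactOperator (kernelLpTwo μ k) :=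
  have h : IsCompactOperator (kernelToBCF μ k ∘ lpTwoToOne μ) :=
    (isCompactOperator_kernelToBCF k).comp_clm (lpTwoToOne μ)
  h.clm_comp (BoundedContinuousFunction.toLp 2 μ ℝ)

theorem inner_kernelLpTwo (k : C(M, C(M, ℝ))) (f g : Lp ℝ 2 μ) :
    inner ℝ (kernelLpTwo μ k f) g = ∫ x, (∫ y, k x y * f y ∂μ) * g x ∂μ := by
  rw [L2.inner_def]
  refine integral_congr_ae ?_
  filter_upwards [coeFn_kernelLpTwo k f] with x hx
  simp [hx, mul_comm]

theorem isSymmetric_kernelLpTwo (k : C(M, C(M, ℝ))) (hk : ∀ x y, k x y = k y x) :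
    (kernelLpTwo μ k).IsSymmetric := by
  intro f g
  show inner ℝ (kernelLpTwo μ k f) g = inner ℝ f (kernelLpTwo μ k g)
  rw [real_inner_comm (kernelLpTwo μ k g) f, inner_kernelLpTwo,
    inner_kernelLpTwo]
  simp_rw [← integral_mul_const]
  rw [integral_integral_swap]
  · refine integral_congr_ae (ae_of_all _ fun y => integral_congr_ae (ae_of_all _ fun x => ?_))
    simp only [hk x y]
    ring
  -- Fubini is justified by a bounded kernel times an integrable tensor product.
  · have hfg : Integrable (fun z : M × M => g z.1 * f z.2) (μ.prod μ) :=
      (integrable_coe_lpTwo g).mul_prod (integrable_coe_lpTwo f)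
    have hkc : Continuous fun z : M × M => k z.1 z.2 := by fun_prop
    have := hfg.bdd_mul (c := ‖k‖) hkc.aestronglyMeasurable (ae_of_all _ fun z =>
      ((k z.1).norm_coe_le_norm z.2).trans (k.norm_coe_le_norm z.1))
    refine this.congr (ae_of_all _ fun z => ?_)
    simp only [Function.uncurry]
    ring

end Kernel

/-! ### Consequences of homogeneity for the measure -/

section Homogeneous

variable {M : Type*} [MetricSpace M] [MeasurableSpace M] [BorelSpace M] {μ : Measure M}
  {O : M} {τ : M → M ≃ᵢ M}

theorem measure_ball_eq_of_homogeneous (hτ : ∀ x, τ x x = O)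
    (hμ : ∀ x, MeasurePreserving (τ x) μ μ) (x : M) (r : ℝ) :
    μ (Metric.ball x r) = μ (Metric.ball O r) := by
  have h : (τ x).symm O = x := by rw [← hτ x, IsometryEquiv.symm_apply_apply]
  rw [← (hμ x).measure_preimage (s := Metric.ball O r) measurableSet_ball.nullMeasurableSet,
    IsometryEquiv.preimage_ball, h]

theorem measure_singleton_eq_of_homogeneous (hτ : ∀ x, τ x x = O)
    (hμ : ∀ x, MeasurePreserving (τ x) μ μ) (x : M) : μ {x} = μ {O} := by
  rw [← (hμ x).measure_preimage (measurableSet_singleton O).nullMeasurableSet]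
  congr 1
  ext y
  simp [← hτ x]

theorem integral_nndist_eq_of_homogeneous (hτ : ∀ x, τ x x = O)
    (hμ : ∀ x, MeasurePreserving (τ x) μ μ) (J : ℝ≥0 → ℝ≥0) (x : M) :
    ∫ y, (J (nndist x y) : ℝ) ∂μ = ∫ y, (J (nndist y O) : ℝ) ∂μ := by
  rw [← (hμ x).integral_comp (τ x).toHomeomorph.measurableEmbedding
    (fun y => (J (nndist y O) : ℝ))]
  refine integral_congr_ae (ae_of_all _ fun y => ?_)
  have : nndist (τ x y) O = nndist x y := by
    rw [← hτ x, (τ x).isometry.nndist_eq, nndist_comm]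
  simp only [this]

/-- Integrability of g, positive at O, makes some ball about O finite; all balls of that radius have
the same measure, and compactness concludes. -/
theorem isFiniteMeasure_of_homogeneous [CompactSpace M] (hτ : ∀ x, τ x x = O)
    (hμ : ∀ x, MeasurePreserving (τ x) μ μ) {g : M → ℝ} (hg : Continuous g)
    (hgi : Integrable g μ) (hO : 0 < g O) : IsFiniteMeasure μ := by
  have h1 : ∀ᶠ y in 𝓝 O, g O / 2 < g y :=
    (hg.tendsto O).eventually_const_lt (half_lt_self hO)
  obtain ⟨r, hr, hball⟩ := Metric.eventually_nhds_iff_ball.1 h1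
  have h2 : μ (Metric.ball O r) < ∞ := by
    refine (measure_mono fun y hy => ?_).trans_lt
      (hgi.measure_norm_ge_lt_top (half_pos hO))
    exact (hball y hy).le.trans (le_abs_self _)
  have : IsLocallyFiniteMeasure μ := ⟨fun x => ⟨Metric.ball x r, Metric.ball_mem_nhds x hr, by
    rwa [measure_ball_eq_of_homogeneous hτ hμ]⟩⟩
  exact CompactSpace.isFiniteMeasure

/-- One null ball would make all balls of its radius null, hence μ = 0. -/
theorem isOpenPosMeasure_of_homogeneous [CompactSpace M] (hτ : ∀ x, τ x x = O)
    (hμ : ∀ x, MeasurePreserving (τ x) μ μ) (h0 : μ ≠ 0) : μ.IsOpenPosMeasure := by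
  refine ⟨fun U hU ⟨x, hx⟩ hzero => h0 ?_⟩
  obtain ⟨r, hr, hball⟩ := Metric.isOpen_iff.1 hU x hx
  have h1 : μ (Metric.ball O r) = 0 := by
    rw [← measure_ball_eq_of_homogeneous hτ hμ x]
    exact measure_mono_null hball hzero
  rw [← Measure.measure_univ_eq_zero]
  refine measure_null_of_locally_null _ fun y _ => ⟨Metric.ball y r,
    mem_nhdsWithin_of_mem_nhds (Metric.ball_mem_nhds y hr), ?_⟩
  rw [measure_ball_eq_of_homogeneous hτ hμ, h1]

/-- All points have equal mass, and a finite measure cannot have infinitely many equal atoms. -/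
theorem measure_singleton_eq_zero_of_homogeneous [Infinite M] [IsFiniteMeasure μ]
    (hτ : ∀ x, τ x x = O) (hμ : ∀ x, MeasurePreserving (τ x) μ μ) : μ {O} = 0 := by
  by_contra h
  have hfin := Measure.finite_const_le_meas_of_disjoint_iUnion μ (pos_iff_ne_zero.2 h)
    (As := fun x : M => {x}) (fun x => measurableSet_singleton x)
    (fun x y hxy => by simpa [Function.onFun] using hxy) (measure_ne_top _ _)
  refine Set.infinite_univ (α := M) (hfin.subset fun x _ => ?_)
  exact (measure_singleton_eq_of_homogeneous hτ hμ x).ge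

end Homogeneous

/-- A nonempty manifold of positive dimension has more than one point. -/
theorem nontrivial_of_chartedSpace {N : ℕ} (hN : 1 ≤ N) {M : Type*} [TopologicalSpace M]
    [ChartedSpace (EuclideanSpace ℝ (Fin N)) M] (O : M) : Nontrivial M := by
  by_contra h
  rw [not_nontrivial_iff_subsingleton] at h
  have : Nonempty (Fin N) := ⟨⟨0, hN⟩⟩
  set e := chartAt (EuclideanSpace ℝ (Fin N)) O
  -- With a single point, the chart target would be an open singleton in a Euclidean space of
  -- positive dimension.
  have h1 : e.target.Subsingleton := fun a ha b hb => by
    rw [← e.right_inv ha, ← e.right_inv hb, Subsingleton.elim (e.symm a) (e.symm b)]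
  have h2 : e.target = {e O} := h1.eq_singleton_of_mem (e.map_source (mem_chart_source _ O))
  have h3 := e.open_target
  rw [h2] at h3
  exact not_isOpen_singleton _ h3

/-- The continuous kernel `J (s_{xy})`. -/
noncomputable def distKernel {M : Type*} [MetricSpace M] [CompactSpace M] (J : ℝ≥0 → ℝ≥0)
    {K : ℝ≥0} (hJ : ∀ x : M, LipschitzWith K fun y : M => J (nndist x y)) : C(M, C(M, ℝ)) where
  toFun x := ⟨fun y => (J (nndist x y) : ℝ), NNReal.continuous_coe.comp (hJ x).continuous⟩
  continuous_toFun := by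
    refine LipschitzWith.continuous (K := K) (LipschitzWith.of_dist_le_mul fun x x' => ?_)
    rw [ContinuousMap.dist_le (by positivity)]
    intro y
    have := (hJ y).dist_le_mul x x'
    rw [nndist_comm y x, nndist_comm y x'] at this
    exact this

theorem inner_const_one_left {α : Type*} [MeasurableSpace α] {μ : Measure α} [IsFiniteMeasure μ]
    (f : Lp ℝ 2 μ) : inner ℝ (Lp.const 2 μ (1 : ℝ)) f = ∫ x, f x ∂μ := by
  rw [← indicatorConstLp_univ, L2.inner_indicatorConstLp_one, setIntegral_univ]

theorem lpTwoToOne_indicatorConstLp {α : Type*} [MeasurableSpace α] {μ : Measure α}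
    [IsFiniteMeasure μ] {s : Set α} (hs : MeasurableSet s) :
    lpTwoToOne μ (indicatorConstLp 2 hs (measure_ne_top μ s) (1 : ℝ)) =
      indicatorConstLp 1 hs (measure_ne_top μ s) 1 := by
  refine Lp.ext ?_
  rw [coe_lpTwoToOne]
  exact indicatorConstLp_coeFn.trans indicatorConstLp_coeFn.symm

/-! ### Markov kernels: maximum principle and test functions -/

section Markov

variable {M : Type*} [MetricSpace M] [CompactSpace M] [MeasurableSpace M] [BorelSpace M]
  {μ : Measure M} [IsFiniteMeasure μ] {k : C(M, C(M, ℝ))}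

theorem kernelLpTwo_const (h1 : ∀ x, ∫ y, k x y ∂μ = 1) :
    kernelLpTwo μ k (Lp.const 2 μ 1) = Lp.const 2 μ 1 := by
  refine Lp.ext ((coeFn_kernelLpTwo k _).trans ?_)
  have hc : ∀ᵐ y ∂μ, (Lp.const 2 μ (1 : ℝ) : M → ℝ) y = 1 := Lp.coeFn_const 2 μ (1 : ℝ)
  filter_upwards [hc] with x hx
  rw [hx]
  refine (integral_congr_ae ?_).trans (h1 x)
  filter_upwards [hc] with y hy
  rw [hy, mul_one]

/-- A continuous function that attains its maximum `m` at `x` and whose weighted average at `x`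
is at least `m` is equal to `m` where the weight is positive. -/
theorem eq_of_average_ge_max [μ.IsOpenPosMeasure] (h0 : ∀ x y, 0 ≤ k x y)
    (h1 : ∀ x, ∫ y, k x y ∂μ = 1) {φ : M → ℝ} (hφ : Continuous φ) {x : M} {m : ℝ}
    (hm : ∀ y, φ y ≤ m) (hx : m ≤ ∫ y, k x y * φ y ∂μ) {y : M} (hy : 0 < k x y) : φ y = m := by
  have hcont : Continuous fun z => k x z * (m - φ z) := by fun_prop
  have hint : ∀ {g : M → ℝ}, Continuous g → Integrable g μ := fun hg =>
    hg.integrable_of_hasCompactSupport (HasCompactSupport.of_compactSpace _)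
  have hnn : 0 ≤ fun z => k x z * (m - φ z) := fun z =>
    mul_nonneg (h0 x z) (sub_nonneg.2 (hm z))
  have hzero : ∫ z, k x z * (m - φ z) ∂μ = 0 := by
    refine le_antisymm ?_ (integral_nonneg hnn)
    have : ∫ z, k x z * (m - φ z) ∂μ = m - ∫ z, k x z * φ z ∂μ := by
      simp_rw [mul_sub]
      rw [integral_sub (hint (by fun_prop)) (hint (by fun_prop)), integral_mul_const, h1, one_mul]
    linarith
  rw [integral_eq_zero_iff_of_nonneg hnn (hint hcont)] at hzero
  have hz := congrFun ((hcont.ae_eq_iff_eq μ continuous_const).1 hzero) y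
  linarith [(mul_eq_zero.1 hz).resolve_left hy.ne']

/-- On a connected space, the eigenvalues of a Markov operator with a kernel that is positive near
the diagonal are less than one on functions of mean zero. -/
theorem eigenvalue_lt_one [ConnectedSpace M] [μ.IsOpenPosMeasure] (h0 : ∀ x y, 0 ≤ k x y)
    (h1 : ∀ x, ∫ y, k x y ∂μ = 1) {s : ℝ} (hs : 0 < s) (hpos : ∀ x y, dist y x < s → 0 < k x y)
    {f : Lp ℝ 2 μ} (hf : f ≠ 0) (hmean : ∫ x, f x ∂μ = 0) {κ : ℝ}
    (heig : kernelLpTwo μ k f = κ • f) : κ < 1 := by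
  by_contra! hκ
  have hκ0 : κ ≠ 0 := by positivity
  -- The continuous representative of f, needed to speak of a maximum.
  set φ : BoundedContinuousFunction M ℝ := κ⁻¹ • kernelToBCF μ k (lpTwoToOne μ f) with hφ
  have hfφ : f =ᵐ[μ] φ := by
    have ha := coeFn_kernelLpTwo k f
    rw [heig] at ha
    filter_upwards [ha, Lp.coeFn_smul κ f] with x hx hx'
    rw [hx', Pi.smul_apply, smul_eq_mul] at hx
    have : φ x = κ⁻¹ * ∫ y, k x y * f y ∂μ := rfl
    rw [this, ← hx, inv_mul_cancel_left₀ hκ0]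
  have hφκ : ∀ x, ∫ y, k x y * φ y ∂μ = κ * φ x := fun x => by
    have : φ x = κ⁻¹ * ∫ y, k x y * f y ∂μ := rfl
    rw [this, mul_inv_cancel_left₀ hκ0]
    refine integral_congr_ae ?_
    filter_upwards [hfφ] with y hy
    rw [hy]
  rw [integral_congr_ae hfφ] at hmean
  obtain ⟨x₀, -, hx₀⟩ := isCompact_univ.exists_isMaxOn (Set.univ_nonempty (α := M))
    φ.continuous.continuousOn
  have hmax : ∀ y, φ y ≤ φ x₀ := fun y => hx₀ (Set.mem_univ y)
  have hvol : 0 < μ.real Set.univ :=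
    ENNReal.toReal_pos (isOpen_univ.measure_ne_zero μ Set.univ_nonempty) (measure_ne_top _ _)
  -- Mean zero forces a nonnegative maximum m, so κ ≥ 1 gives m ≤ κ m, as the maximum principle
  -- requires.
  have hm0 : 0 ≤ φ x₀ := by
    have : ∫ y, φ y ∂μ ≤ ∫ _, φ x₀ ∂μ :=
      integral_mono (φ.integrable μ) (integrable_const _) hmax
    rw [hmean, integral_const, smul_eq_mul] at this
    exact nonneg_of_mul_nonneg_right this hvol
  have hclopen : IsClopen {x | φ x = φ x₀} := by
    refine ⟨isClosed_eq φ.continuous continuous_const, Metric.isOpen_iff.2 fun x hx => ?_⟩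
    refine ⟨s, hs, fun y hy => eq_of_average_ge_max h0 h1 φ.continuous hmax ?_ (hpos x y hy)⟩
    rw [hφκ, show φ x = φ x₀ from hx]
    exact le_mul_of_one_le_left hm0 hκ
  have hconst : ∀ x, φ x = φ x₀ := fun x => by
    have hx : x ∈ {x | φ x = φ x₀} := by
      rw [hclopen.eq_univ ⟨x₀, rfl⟩]
      exact Set.mem_univ x
    exact hx
  have hφ0 : φ x₀ = 0 := by
    simp_rw [hconst] at hmean
    rw [integral_const, smul_eq_mul] at hmean
    exact (mul_eq_zero.1 hmean).resolve_left hvol.ne'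
  refine hf ((Lp.eq_zero_iff_ae_eq_zero).2 ?_)
  filter_upwards [hfφ] with x hx
  rw [hx, hconst, hφ0, Pi.zero_apply]

/-- The L¹ norm is the point: on functions concentrated on small sets it is much smaller than the L²
norm. -/
theorem abs_inner_kernelLpTwo_le (f : Lp ℝ 2 μ) :
    |inner ℝ (kernelLpTwo μ k f) f| ≤ ‖k‖ * ‖lpTwoToOne μ f‖ ^ 2 := by
  rw [inner_kernelLpTwo]
  have h := abs_integral_continuousMap_mul_le
    (μ := μ) (kernelToBCF μ k (lpTwoToOne μ f)).toContinuousMap (lpTwoToOne μ f)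
  refine h.trans ?_
  have h2 : ‖(kernelToBCF μ k (lpTwoToOne μ f)).toContinuousMap‖ ≤ ‖k‖ * ‖lpTwoToOne μ f‖ := by
    rw [ContinuousMap.norm_le _ (by positivity)]
    intro x
    exact (abs_integral_continuousMap_mul_le (k x) _).trans
      (mul_le_mul_of_nonneg_right (k.norm_coe_le_norm x) (norm_nonneg _))
  refine (mul_le_mul_of_nonneg_right h2 (norm_nonneg _)).trans_eq ?_
  ring

/-- The quadratic form of an integral operator with continuous kernel is not bounded away from zero
from above on functions of mean zero, if there are disjoint small balls of equal measure. -/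
theorem nonneg_of_inner_kernelLpTwo_le [μ.IsOpenPosMeasure] {O : M} [(𝓝[≠] O).NeBot]
    (hO : μ {O} = 0) (hball : ∀ x r, μ (Metric.ball x r) = μ (Metric.ball O r)) {c : ℝ}
    (hc : ∀ f : Lp ℝ 2 μ, ∫ x, f x ∂μ = 0 → inner ℝ (kernelLpTwo μ k f) f ≤ c * ‖f‖ ^ 2) :
    0 ≤ c := by
  -- Test with the difference of the indicators of two disjoint balls of equal measure a: its
  -- squared L² norm is 2a, while the form is at most ‖k‖(2a)² in absolute value.
  have key : ∀ r > 0, -(2 * ‖k‖ * μ.real (Metric.ball O r)) ≤ c := by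
    intro r hr
    obtain ⟨p, hpr, hpO⟩ : ∃ p ∈ Metric.ball O r, p ≠ O := by
      have h := (eventually_nhdsWithin_of_eventually_nhds (s := {O}ᶜ)
        (Metric.ball_mem_nhds O hr)).and self_mem_nhdsWithin
      obtain ⟨p, hp⟩ := h.exists
      exact ⟨p, hp.1, hp.2⟩
    have hd : 0 < dist p O := dist_pos.2 hpO
    set ρ := dist p O / 2 with hρ
    have hρ0 : 0 < ρ := half_pos hd
    have hdisj : Disjoint (Metric.ball O ρ) (Metric.ball p ρ) :=
      Metric.ball_disjoint_ball (by rw [dist_comm]; linarith)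
    have hρr : ρ ≤ r := by
      rw [Metric.mem_ball] at hpr
      linarith
    set a := μ.real (Metric.ball O ρ) with ha
    have hap : μ.real (Metric.ball p ρ) = a := by rw [ha, measureReal_def, hball, measureReal_def]
    have ha0 : 0 < a := ENNReal.toReal_pos (Metric.measure_ball_pos μ O hρ0).ne'
      (measure_ne_top _ _)
    have har : a ≤ μ.real (Metric.ball O r) := measureReal_mono (Metric.ball_subset_ball hρr)
    set A : Lp ℝ 2 μ := indicatorConstLp 2 (measurableSet_ball (x := O) (ε := ρ))
      (measure_ne_top μ _) 1 with hA
    set B : Lp ℝ 2 μ := indicatorConstLp 2 (measurableSet_ball (x := p) (ε := ρ))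
      (measure_ne_top μ _) 1 with hB
    have hAA : inner ℝ A A = a := by
      rw [hA, L2.real_inner_indicatorConstLp_one_indicatorConstLp_one, Set.inter_self]
    have hBB : inner ℝ B B = a := by
      rw [hB, L2.real_inner_indicatorConstLp_one_indicatorConstLp_one, Set.inter_self, hap]
    have hAB : inner ℝ A B = 0 := by
      rw [hA, hB, L2.real_inner_indicatorConstLp_one_indicatorConstLp_one, hdisj.inter_eq]
      simp
    have hmean : ∫ x, (A - B : Lp ℝ 2 μ) x ∂μ = 0 := by
      rw [← inner_const_one_left, inner_sub_right, ← indicatorConstLp_univ, hA, hB,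
        L2.real_inner_indicatorConstLp_one_indicatorConstLp_one,
        L2.real_inner_indicatorConstLp_one_indicatorConstLp_one, Set.univ_inter, Set.univ_inter,
        hap, sub_self]
    have hnorm : ‖A - B‖ ^ 2 = 2 * a := by
      rw [norm_sub_sq_real, ← real_inner_self_eq_norm_sq, ← real_inner_self_eq_norm_sq, hAA, hBB,
        hAB]
      ring
    have hone : ‖lpTwoToOne μ (A - B)‖ ≤ 2 * a := by
      rw [map_sub]
      refine (norm_sub_le _ _).trans ?_
      rw [hA, hB, lpTwoToOne_indicatorConstLp, lpTwoToOne_indicatorConstLp,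
        norm_indicatorConstLp one_ne_zero ENNReal.one_ne_top,
        norm_indicatorConstLp one_ne_zero ENNReal.one_ne_top, hap, ← ha]
      simp only [norm_one, ENNReal.toReal_one, div_one, Real.rpow_one, one_mul]
      linarith
    have h1 := hc _ hmean
    have h2 := neg_le_of_abs_le (abs_inner_kernelLpTwo_le (k := k) (A - B))
    have h3 : ‖k‖ * ‖lpTwoToOne μ (A - B)‖ ^ 2 ≤ ‖k‖ * (2 * a) ^ 2 := by gcongr
    rw [hnorm] at h1
    have h4 : (2 * a) * -(2 * ‖k‖ * a) ≤ (2 * a) * c := by linarith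
    have h5 := le_of_mul_le_mul_left h4 (by positivity)
    have h6 : 2 * ‖k‖ * a ≤ 2 * ‖k‖ * μ.real (Metric.ball O r) := by gcongr
    linarith
  have hlim : Tendsto (fun r : ℝ => μ.real (Metric.closedBall O r)) (𝓝[>] 0) (𝓝 0) := by
    have h := tendsto_measure_cthickening_of_isClosed (μ := μ) (s := {O})
      ⟨1, one_pos, measure_ne_top _ _⟩ isClosed_singleton
    rw [hO] at h
    have h2 := (ENNReal.tendsto_toReal ENNReal.zero_ne_top).comp
      (h.mono_left (nhdsWithin_le_nhds (s := Set.Ioi (0 : ℝ))))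
    refine h2.congr' (eventually_nhdsWithin_of_forall fun r hr => ?_)
    simp only [Function.comp, measureReal_def]
    rw [Metric.cthickening_singleton O (le_of_lt hr)]
  have hlim2 : Tendsto (fun r : ℝ => -(2 * ‖k‖ * μ.real (Metric.closedBall O r))) (𝓝[>] 0)
      (𝓝 0) := by
    simpa using (hlim.const_mul (2 * ‖k‖)).neg
  refine le_of_tendsto hlim2 (eventually_nhdsWithin_of_forall fun r hr => ?_)
  have h7 : μ.real (Metric.ball O r) ≤ μ.real (Metric.closedBall O r) :=
    measureReal_mono Metric.ball_subset_closedBall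
  have h8 : 2 * ‖k‖ * μ.real (Metric.ball O r) ≤ 2 * ‖k‖ * μ.real (Metric.closedBall O r) := by
    gcongr
  linarith [key r hr]

end Markov

/-! ### Spectral gap and decay on functions of mean zero -/

section MeanZero

/-- The functions of mean zero in `L²`. -/
noncomputable def meanZero {α : Type*} [MeasurableSpace α] (μ : Measure α) [IsFiniteMeasure μ] :
    Submodule ℝ (Lp ℝ 2 μ) :=
  (Submodule.span ℝ {Lp.const 2 μ (1 : ℝ)})ᗮ

theorem mem_meanZero {α : Type*} [MeasurableSpace α] {μ : Measure α} [IsFiniteMeasure μ]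
    {f : Lp ℝ 2 μ} : f ∈ meanZero μ ↔ ∫ x, f x ∂μ = 0 := by
  rw [meanZero, Submodule.mem_orthogonal_singleton_iff_inner_right, inner_const_one_left]

instance {α : Type*} [MeasurableSpace α] (μ : Measure α) [IsFiniteMeasure μ] :
    CompleteSpace (meanZero μ) :=
  inferInstanceAs (CompleteSpace (Submodule.span ℝ {Lp.const 2 μ (1 : ℝ)})ᗮ)

variable {M : Type*} [MetricSpace M] [CompactSpace M] [MeasurableSpace M] [BorelSpace M]
  {μ : Measure M} [IsFiniteMeasure μ] {k : C(M, C(M, ℝ))}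

theorem integral_kernelLpTwo (hk : ∀ x y, k x y = k y x) (h1 : ∀ x, ∫ y, k x y ∂μ = 1)
    (f : Lp ℝ 2 μ) : ∫ x, kernelLpTwo μ k f x ∂μ = ∫ x, f x ∂μ := by
  rw [← inner_const_one_left, ← inner_const_one_left]
  have h : inner ℝ (kernelLpTwo μ k (Lp.const 2 μ 1)) f =
      inner ℝ (Lp.const 2 μ 1) (kernelLpTwo μ k f) := isSymmetric_kernelLpTwo k hk _ _
  rw [← h, kernelLpTwo_const h1]

theorem kernelLpTwo_mem_meanZero (hk : ∀ x y, k x y = k y x) (h1 : ∀ x, ∫ y, k x y ∂μ = 1) :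
    ∀ f ∈ meanZero μ, kernelLpTwo μ k f ∈ meanZero μ := fun f hf => by
  rw [mem_meanZero] at hf ⊢
  rw [integral_kernelLpTwo hk h1, hf]

/-- The restriction of a symmetric Markov operator to functions of mean zero. -/
noncomputable def kernelMeanZero (hk : ∀ x y, k x y = k y x) (h1 : ∀ x, ∫ y, k x y ∂μ = 1) :
    meanZero μ →L[ℝ] meanZero μ :=
  (kernelLpTwo μ k).restrict (kernelLpTwo_mem_meanZero hk h1)

theorem coe_kernelMeanZero (hk : ∀ x y, k x y = k y x) (h1 : ∀ x, ∫ y, k x y ∂μ = 1)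
    (f : meanZero μ) : (kernelMeanZero hk h1 f : Lp ℝ 2 μ) = kernelLpTwo μ k f := rfl

theorem hasEigenvalue_kernelMeanZero_iff (hk : ∀ x y, k x y = k y x)
    (h1 : ∀ x, ∫ y, k x y ∂μ = 1) {κ : ℝ} :
    Module.End.HasEigenvalue (kernelMeanZero hk h1 : Module.End ℝ (meanZero μ)) κ ↔
      ∃ f : Lp ℝ 2 μ, f ≠ 0 ∧ ∫ x, f x ∂μ = 0 ∧ kernelLpTwo μ k f = κ • f := by
  constructor
  · intro h
    obtain ⟨f, hf⟩ := h.exists_hasEigenvector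
    refine ⟨f, by simpa using hf.2, mem_meanZero.1 f.2, ?_⟩
    exact congrArg Subtype.val hf.apply_eq_smul
  · rintro ⟨f, hf, hmean, heig⟩
    refine Module.End.hasEigenvalue_of_hasEigenvector (x := ⟨f, mem_meanZero.2 hmean⟩)
      ⟨Module.End.mem_eigenspace_iff.2 (Subtype.ext heig), ?_⟩
    simpa using hf

/-- The spectral gap of a symmetric Markov operator: the least upper bound `c` of the eigenvalues
on functions of mean zero satisfies `0 ≤ c < 1`, bounds the quadratic form, and is attained unless
it is zero. -/
theorem exists_spectral_gap [ConnectedSpace M] [Nontrivial M] [μ.IsOpenPosMeasure] {O : M}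
    (hO : μ {O} = 0) (hball : ∀ x r, μ (Metric.ball x r) = μ (Metric.ball O r))
    (hk : ∀ x y, k x y = k y x) (h0 : ∀ x y, 0 ≤ k x y) (h1 : ∀ x, ∫ y, k x y ∂μ = 1)
    {s : ℝ} (hs : 0 < s) (hpos : ∀ x y, dist y x < s → 0 < k x y) :
    ∃ c : ℝ, c < 1 ∧
      IsLUB {κ | Module.End.HasEigenvalue (kernelMeanZero hk h1 : Module.End ℝ (meanZero μ)) κ} c ∧
      (c ≠ 0 →
        Module.End.HasEigenvalue (kernelMeanZero hk h1 : Module.End ℝ (meanZero μ)) c) ∧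
      ∀ f : meanZero μ, inner ℝ (kernelMeanZero hk h1 f) f ≤ c * ‖f‖ ^ 2 := by
  set S := kernelMeanZero hk h1 with hS
  have hcomp : IsCompactOperator S :=
    (isCompactOperator_kernelLpTwo k).restrict' (kernelLpTwo_mem_meanZero hk h1)
  have hsymm : S.IsSymmetric := fun f g => isSymmetric_kernelLpTwo k hk (f : Lp ℝ 2 μ) g
  -- Were this space trivial, the form bound would hold even with the constant -1, contradicting
  -- nonnegativity of such constants.
  have hnt : Nontrivial (meanZero μ) := by
    by_contra hsub
    rw [not_nontrivial_iff_subsingleton] at hsub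
    have h := nonneg_of_inner_kernelLpTwo_le (k := k) (c := -1) hO hball fun f hf => by
      have hz : f = 0 := congrArg Subtype.val
        (Subsingleton.elim (⟨f, mem_meanZero.2 hf⟩ : meanZero μ) 0)
      simp [hz]
    linarith
  have hne := exists_hasEigenvalue_of_isCompactOperator hcomp hsymm
  obtain ⟨c, hc⟩ := Real.exists_isLUB
    (s := {κ | Module.End.HasEigenvalue (S : Module.End ℝ (meanZero μ)) κ}) hne
    ⟨‖S‖, fun κ hκ => le_opNorm_of_hasEigenvalue hκ⟩
  have hattain : c ≠ 0 → Module.End.HasEigenvalue (S : Module.End ℝ (meanZero μ)) c :=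
    hasEigenvalue_of_isLUB hcomp hne hc
  refine ⟨c, ?_, hc, hattain,
    inner_apply_le_of_hasEigenvalue_le hcomp hsymm fun κ hκ => hc.1 hκ⟩
  by_cases hc0 : c = 0
  · rw [hc0]; exact one_pos
  · obtain ⟨f, hf, hmean, heig⟩ := (hasEigenvalue_kernelMeanZero_iff hk h1).1 (hattain hc0)
    exact eigenvalue_lt_one h0 h1 hs hpos hf hmean heig

variable {J : ℝ≥0 → ℝ≥0}

/-- Since T preserves integrals, integrating Tf = (1 - l)f gives l∫f = 0, so l ≠ 0 forces mean zero.
Conversely l = 0 would make 1 an eigenvalue on mean-zero functions. -/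
theorem mem_nonzeroEigenvalues_iff (hJk : ∀ x y, (J (nndist x y) : ℝ) = k x y)
    (hk : ∀ x y, k x y = k y x) (h1 : ∀ x, ∫ y, k x y ∂μ = 1)
    (hlt : ∀ κ, Module.End.HasEigenvalue (kernelMeanZero hk h1 : Module.End ℝ (meanZero μ)) κ →
      κ < 1) {l : ℝ} :
    l ∈ nonzeroEigenvalues J μ ↔
      Module.End.HasEigenvalue (kernelMeanZero hk h1 : Module.End ℝ (meanZero μ)) (1 - l) := by
  have hop : ∀ f : Lp ℝ 2 μ, (∀ᵐ x ∂μ, -nonlocalOp J μ f x = l * f x) ↔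
      kernelLpTwo μ k f = (1 - l) • f := fun f => by
    rw [Lp.ext_iff]
    constructor
    · intro h
      filter_upwards [h, coeFn_kernelLpTwo k f, Lp.coeFn_smul (1 - l) f] with x hx hx1 hx2
      rw [hx1, hx2, Pi.smul_apply, smul_eq_mul]
      simp only [nonlocalOp, hJk] at hx
      linarith
    · intro h
      filter_upwards [h, coeFn_kernelLpTwo k f, Lp.coeFn_smul (1 - l) f] with x hx hx1 hx2
      rw [hx1, hx2, Pi.smul_apply, smul_eq_mul] at hx
      simp only [nonlocalOp, hJk]
      linarith
  constructor
  · rintro ⟨hl, f, hf, heig⟩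
    rw [hop] at heig
    refine (hasEigenvalue_kernelMeanZero_iff hk h1).2 ⟨f, hf, ?_, heig⟩
    have h := integral_kernelLpTwo hk h1 f
    rw [heig, ← inner_const_one_left, ← inner_const_one_left, inner_smul_right,
      inner_const_one_left] at h
    have h2 : l * ∫ x, f x ∂μ = 0 := by linarith
    exact (mul_eq_zero.1 h2).resolve_left hl
  · intro h
    refine ⟨fun hl => ?_, ?_⟩
    · have := hlt _ h
      linarith
    · obtain ⟨f, hf, -, heig⟩ := (hasEigenvalue_kernelMeanZero_iff hk h1).1 h
      exact ⟨f, hf, (hop f).2 heig⟩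

/-- A solution of the nonlocal diffusion equation with initial value in `L²` is the constant mean
value plus a solution among the functions of mean zero in `L²`. -/
theorem solution_eq_meanZero_add_const (hJk : ∀ x y, (J (nndist x y) : ℝ) = k x y)
    (hk : ∀ x y, k x y = k y x) (h1 : ∀ x, ∫ y, k x y ∂μ = 1) {u₀ : M → ℝ} {u : ℝ → Lp ℝ 1 μ}
    (hu : IsNonlocalSolution J μ u₀ u) {a : ℝ} {y : ℝ → meanZero μ}
    (hyd : ∀ t, HasDerivAt y ((kernelMeanZero hk h1 - ContinuousLinearMap.id ℝ (meanZero μ)) (y t)) t)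
    (hy0 : u₀ =ᵐ[μ] ((y 0 : Lp ℝ 2 μ) + a • Lp.const 2 μ (1 : ℝ) : Lp ℝ 2 μ)) {t : ℝ}
    (ht : 0 ≤ t) :
    u t = lpTwoToOne μ ((y t : Lp ℝ 2 μ) + a • Lp.const 2 μ (1 : ℝ)) := by
  set w : ℝ → Lp ℝ 1 μ := fun t => lpTwoToOne μ ((y t : Lp ℝ 2 μ) + a • Lp.const 2 μ (1 : ℝ))
    with hw
  have hwd : ∀ t, HasDerivAt w ((kernelLpOne μ k - 1) (w t)) t := fun t => by
    have h2 : HasDerivAt (fun t => (y t : Lp ℝ 2 μ)) ((kernelMeanZero hk h1 (y t) - y t : meanZero μ) : Lp ℝ 2 μ) t :=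
      (meanZero μ).subtypeL.hasFDerivAt.comp_hasDerivAt t (hyd t)
    have h3 := (lpTwoToOne μ).hasFDerivAt.comp_hasDerivAt t
      (h2.add_const (a • Lp.const 2 μ (1 : ℝ)))
    refine h3.congr_deriv ?_
    -- Constants are stationary, so adding the mean preserves the equation.
    have hc : kernelLpOne μ k (lpTwoToOne μ (Lp.const 2 μ 1)) = lpTwoToOne μ (Lp.const 2 μ 1) := by
      rw [← lpTwoToOne_kernelLpTwo, kernelLpTwo_const h1]
    simp only [hw, sub_apply, one_apply_eq_self, map_add, map_smul,
      hc, Submodule.coe_sub, map_sub, coe_kernelMeanZero, lpTwoToOne_kernelLpTwo,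
      sub_self, smul_zero, add_zero]
  have hud : ∀ t, 0 < t → HasDerivAt u ((kernelLpOne μ k - 1) (u t)) t := fun t ht => by
    obtain ⟨z, hz, hd⟩ := hu.equation t ht
    have : z = (kernelLpOne μ k - 1) (u t) := by
      refine Lp.ext ?_
      rw [sub_apply, one_apply_eq_self]
      filter_upwards [hz, Lp.coeFn_sub (kernelLpOne μ k (u t)) (u t),
        coeFn_kernelLpOne k (u t)] with x hx1 hx2 hx3
      rw [hx1, hx2, Pi.sub_apply, hx3]
      simp only [nonlocalOp, hJk]
    rwa [← this]
  have hinit : u 0 - w 0 = 0 := by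
    rw [sub_eq_zero]
    exact Lp.ext (hu.initial.trans hy0)
  refine sub_eq_zero.1 (eqOn_zero_of_hasDerivAt_clm (kernelLpOne μ k - 1) (d := fun t => u t - w t)
    (hu.continuousOn.sub fun t _ => (hwd t).continuousAt.continuousWithinAt) hinit
    (fun t ht => ?_) ht)
  rw [map_sub]
  exact (hud t ht).sub (hwd t)

/-- Exponential decay to the mean value in `L²`. -/
theorem eLpNorm_solution_sub_average_le [NeZero μ] (hJk : ∀ x y, (J (nndist x y) : ℝ) = k x y)
    (hk : ∀ x y, k x y = k y x) (h1 : ∀ x, ∫ y, k x y ∂μ = 1) {c : ℝ}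
    (hc : ∀ f : meanZero μ, inner ℝ (kernelMeanZero hk h1 f) f ≤ c * ‖f‖ ^ 2)
    {u₀ : M → ℝ} (hu₀ : MemLp u₀ 2 μ) {u : ℝ → Lp ℝ 1 μ}
    (hu : IsNonlocalSolution J μ u₀ u) {t : ℝ} (ht : 0 ≤ t) :
    eLpNorm (fun x => u t x - ⨍ y, u₀ y ∂μ) 2 μ
      ≤ ENNReal.ofReal (Real.exp (-(1 - c) * t)) * eLpNorm u₀ 2 μ := by
  set a := ⨍ y, u₀ y ∂μ with ha
  set e : Lp ℝ 2 μ := Lp.const 2 μ 1 with he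
  set w := hu₀.toLp u₀ with hw
  have hvol : μ.real Set.univ ≠ 0 :=
    (ENNReal.toReal_pos (NeZero.ne _) (measure_ne_top μ _)).ne'
  have hee : inner ℝ e e = μ.real Set.univ := by
    rw [he, ← indicatorConstLp_univ, L2.real_inner_indicatorConstLp_one_indicatorConstLp_one,
      Set.inter_self]
  have hperp : inner ℝ e (w - a • e) = 0 := by
    rw [inner_sub_right, inner_smul_right, hee, he, inner_const_one_left,
      integral_congr_ae hu₀.coeFn_toLp, ha, average_eq, smul_eq_mul]
    field_simp
    ring
  have hmem : w - a • e ∈ meanZero μ := by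
    rwa [mem_meanZero, ← inner_const_one_left]
  obtain ⟨y, hy0, hyd⟩ := exists_hasDerivAt_clm
    (kernelMeanZero hk h1 - ContinuousLinearMap.id ℝ (meanZero μ)) ⟨w - a • e, hmem⟩
  have hsol := solution_eq_meanZero_add_const hJk hk h1 hu (a := a) (y := y) hyd
    (by
      have : (w - a • e) + a • e = w := sub_add_cancel _ _
      simp only [← he, hy0, this]
      exact hu₀.coeFn_toLp.symm) ht
  have hae : (fun x => u t x - a) =ᵐ[μ] (y t : Lp ℝ 2 μ) := by
    rw [hsol, coe_lpTwoToOne]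
    have h1 : ∀ᵐ x ∂μ, (Lp.const 2 μ (1 : ℝ) : M → ℝ) x = 1 := Lp.coeFn_const 2 μ (1 : ℝ)
    filter_upwards [h1, Lp.coeFn_add (y t : Lp ℝ 2 μ) (a • Lp.const 2 μ (1 : ℝ)),
      Lp.coeFn_smul a (Lp.const 2 μ (1 : ℝ))] with x hx1 hx2 hx3
    rw [hx2, Pi.add_apply, hx3, Pi.smul_apply, hx1]
    simp
  -- Pythagoras: subtracting the mean is an orthogonal projection.
  have hnorm : ‖w - a • e‖ ≤ ‖w‖ := by
    have h : ‖w‖ ^ 2 = ‖w - a • e‖ ^ 2 + ‖a • e‖ ^ 2 := by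
      have h2 := norm_add_sq_real (w - a • e) (a • e)
      rw [sub_add_cancel, inner_smul_right, real_inner_comm, hperp] at h2
      linarith
    refine le_of_sq_le_sq ?_ (norm_nonneg _)
    nlinarith [sq_nonneg ‖a • e‖]
  have hdecay : ‖(y t : Lp ℝ 2 μ)‖ ≤ Real.exp (-(1 - c) * t) * ‖w‖ := by
    have h := norm_le_exp_mul_of_hasDerivAt_clm (l := 1 - c) (fun f => by
      rw [sub_apply, ContinuousLinearMap.id_apply, inner_sub_left, real_inner_self_eq_norm_sq]
      linarith [hc f]) hyd ht
    rw [hy0] at h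
    exact h.trans (mul_le_mul_of_nonneg_left hnorm (Real.exp_pos _).le)
  rw [eLpNorm_congr_ae hae, ← eLpNorm_congr_ae hu₀.coeFn_toLp, ← Lp.enorm_def, ← Lp.enorm_def,
    ← ofReal_norm, ← ofReal_norm, ← ENNReal.ofReal_mul (Real.exp_pos _).le]
  exact ENNReal.ofReal_le_ofReal hdecay

end MeanZero

/-! ### The main theorem -/

theorem mainTheorem7 {N : ℕ} (hN : 1 ≤ N)
    {M : Type*} [MetricSpace M] [ChartedSpace (EuclideanSpace ℝ (Fin N)) M]
    [IsManifold (𝓡 N) 1 M]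
    [RiemannianBundle (fun x : M => TangentSpace (𝓡 N) x)]
    [IsContinuousRiemannianBundle (EuclideanSpace ℝ (Fin N))
      (fun x : M => TangentSpace (𝓡 N) x)]
    [IsRiemannianManifold (𝓡 N) M]
    [CompactSpace M] [ConnectedSpace M]
    [MeasurableSpace M] [BorelSpace M] (μ : Measure M)
    (O : M) (τ : M → M ≃ᵢ M) (hτ : ∀ x, τ x x = O)
    (hμ : ∀ x, MeasurePreserving (τ x) μ μ)
    (J : ℝ≥0 → ℝ≥0)
    (hJ_mass : ∫ x, (J (nndist x O) : ℝ) ∂μ = 1)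
    (hJ_pos : ∃ s₀ : ℝ≥0, 0 < s₀ ∧ ∀ s < s₀, 0 < J s)
    (hJ_lip : ∃ K : ℝ≥0, ∀ x : M, LipschitzWith K (fun y : M => J (nndist x y))) :
    ∃ lam₁ : ℝ, 0 < lam₁ ∧ IsGLB (nonzeroEigenvalues J μ) lam₁ ∧
      (lam₁ ≠ 1 → lam₁ ∈ nonzeroEigenvalues J μ) ∧
      ∀ u₀ : M → ℝ, MemLp u₀ 2 μ →
      ∀ u : ℝ → Lp ℝ 1 μ, IsNonlocalSolution J μ u₀ u →
        (∀ t : ℝ, 0 ≤ t →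
          eLpNorm (fun x => u t x - ⨍ y, u₀ y ∂μ) 2 μ
            ≤ ENNReal.ofReal (Real.exp (-lam₁ * t)) * eLpNorm u₀ 2 μ) ∧
        Tendsto (fun t : ℝ => eLpNorm (fun x => u t x - ⨍ y, u₀ y ∂μ) 2 μ) atTop (𝓝 0) := by
  obtain ⟨s₀, hs₀, hJpos⟩ := hJ_pos
  obtain ⟨K, hK⟩ := hJ_lip
  have : Nontrivial M := nontrivial_of_chartedSpace hN O
  have : Infinite M := PreconnectedSpace.infinite
  have hμ0 : μ ≠ 0 := by
    rintro rfl
    simp at hJ_mass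
  have hJi : Integrable (fun x => (J (nndist x O) : ℝ)) μ := by
    by_contra h
    rw [integral_undef h] at hJ_mass
    exact zero_ne_one hJ_mass
  have hJc : Continuous fun x : M => (J (nndist x O) : ℝ) := by
    simp_rw [nndist_comm _ O]
    exact NNReal.continuous_coe.comp (hK O).continuous
  have : IsFiniteMeasure μ := isFiniteMeasure_of_homogeneous hτ hμ hJc hJi (by
    simpa using hJpos 0 hs₀)
  have : μ.IsOpenPosMeasure := isOpenPosMeasure_of_homogeneous hτ hμ hμ0
  have : NeZero μ := ⟨hμ0⟩
  set k := distKernel J hK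
  have hJk : ∀ x y, (J (nndist x y) : ℝ) = k x y := fun _ _ => rfl
  have hk : ∀ x y, k x y = k y x := fun x y => by rw [← hJk, ← hJk, nndist_comm]
  have hk1 : ∀ x, ∫ y, k x y ∂μ = 1 := fun x =>
    (integral_nndist_eq_of_homogeneous hτ hμ J x).trans hJ_mass
  obtain ⟨c, hc1, hlub, hatt, hquad⟩ := exists_spectral_gap
    (measure_singleton_eq_zero_of_homogeneous hτ hμ) (measure_ball_eq_of_homogeneous hτ hμ)
    hk (fun x y => NNReal.coe_nonneg _) hk1 (s := s₀) hs₀ (fun x y hxy => by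
      rw [← hJk]
      refine NNReal.coe_pos.2 (hJpos _ ?_)
      rw [nndist_comm]
      exact hxy)
  have hmem : ∀ {l : ℝ}, _ ↔ _ := fun {l} => mem_nonzeroEigenvalues_iff hJk hk hk1
    (fun κ hκ => (hlub.1 hκ).trans_lt hc1) (l := l)
  -- The map κ ↦ 1 - κ turns the least upper bound c into a greatest lower bound. Its existence in ℝ
  -- already entails that there are nonzero eigenvalues, as the empty set has none.
  refine ⟨1 - c, sub_pos.2 hc1, ⟨fun l hl => ?_, fun b hb => ?_⟩, fun hne => ?_,
    fun u₀ hu₀ u hu => ?_⟩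
  · linarith [hlub.1 (hmem.1 hl)]
  · have h : c ≤ 1 - b := hlub.2 fun κ hκ => by
      have h2 : b ≤ 1 - κ := hb (hmem.2 (by rwa [sub_sub_cancel]))
      linarith
    linarith
  · refine hmem.2 ?_
    rw [sub_sub_cancel]
    exact hatt fun h => hne (by rw [h, sub_zero])
  · have hdecay : ∀ t : ℝ, 0 ≤ t → eLpNorm (fun x => u t x - ⨍ y, u₀ y ∂μ) 2 μ
        ≤ ENNReal.ofReal (Real.exp (-(1 - c) * t)) * eLpNorm u₀ 2 μ := fun t ht =>
      eLpNorm_solution_sub_average_le hJk hk hk1 hquad hu₀ hu ht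
    refine ⟨hdecay, ?_⟩
    have hexp : Tendsto (fun t : ℝ => Real.exp (-(1 - c) * t)) atTop (𝓝 0) :=
      Real.tendsto_exp_atBot.comp
        (tendsto_id.const_mul_atTop_of_neg (by linarith : -(1 - c) < 0))
    have hbound : Tendsto
        (fun t : ℝ => ENNReal.ofReal (Real.exp (-(1 - c) * t)) * eLpNorm u₀ 2 μ) atTop (𝓝 0) := by
      have h := ENNReal.Tendsto.mul_const (ENNReal.tendsto_ofReal hexp)
        (Or.inr hu₀.eLpNorm_ne_top)
      simpa using h
    exact tendsto_of_tendsto_of_tendsto_of_le_of_le' tendsto_const_nhds hbound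
      (Eventually.of_forall fun _ => zero_le) ((eventually_ge_atTop 0).mono hdecay)
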